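/- Let $G$ be any probability distribution on $\mathbb{N}=\{1,2,\dots\}$ (its mean may be infinite). Then there exist a stationary real-valued sequence $\{X_k\}_{k\ge 0}$, a strictly increasing real sequence $\{u_n\}_{n\ge 1}$ and a number $\lambda\in(0,\infty)$ such that the time-scaled point processes of exceedances \[ N_n(A)=\#\{k\ge 0:\ k/n\in A,\ X_k>u_n\},\qquad A\in\mathcal{B}([0,\infty)), \] converge in distribution as $n\to\infty$, as random elements of the space of locally finite measures on $[0,\infty)$ with the vague topology, to a compound Poisson process with intensity $\lambda$ and compounding law $G$. The latter is the random measure $N=\sum_{i\ge 1}\zeta_i\,\delta_{T_i}$, where $0<T_1<T_2<\cdots$ are the points of a homogeneous Poisson process of rate $\lambda$ on $[0,\infty)$ and the multiplicities $\zeta_1,\zeta_2,\dots$ are i.i.d. with law $G$ and independent of $(T_i)_{i\ge 1}$. -/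

import Mathlib

open MeasureTheory ProbabilityTheory Filter Topology
open scoped NNReal ENNReal CompactlySupported

/-- A locally finite Borel measure on the half-line `[0, ∞)`. -/
structure LocFinMeasure where
  toMeasure : Measure ℝ≥0
  locallyFinite : IsLocallyFiniteMeasure toMeasure

namespace LocFinMeasure

/-- The vague topology: the coarsest topology for which `μ ↦ ∫ f dμ` is continuous for every
continuous compactly supported `f : [0, ∞) → ℝ`. -/
noncomputable instance : TopologicalSpace LocFinMeasure :=
  TopologicalSpace.induced
    (fun (μ : LocFinMeasure) (f : C_c(ℝ≥0, ℝ)) => ∫ x, f x ∂μ.toMeasure) inferInstance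

/-- The Borel σ-algebra of the vague topology. -/
noncomputable instance : MeasurableSpace LocFinMeasure := borel LocFinMeasure

instance : BorelSpace LocFinMeasure := ⟨rfl⟩

end LocFinMeasure

/-- Stationarity of a real process `(X k)`, `k ≥ 0`: for every `l` the shifted process
`(X (l + k))` has the same law on the sequence space as `(X k)`. -/
def IsStationaryProcess {Ω : Type*} [MeasurableSpace Ω] (X : ℕ → Ω → ℝ) (P : Measure Ω) : Prop :=
  (∀ k, Measurable (X k)) ∧
    ∀ l : ℕ, IdentDistrib (fun ω k => X (l + k) ω) (fun ω k => X k ω) P P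

/-- For a path `x`, a scale `n` and a level `u`, the counting measure
`A ↦ #{k : k / n ∈ A, x k > u}` on `[0, ∞)`. -/
noncomputable def exceedanceMeasure (n : ℕ+) (u : ℝ) (x : ℕ → ℝ) : Measure ℝ≥0 :=
  (Measure.count.restrict {k : ℕ | u < x k}).map fun k : ℕ => (k : ℝ≥0) / ((n : ℕ) : ℝ≥0)

theorem exceedanceMeasure_apply (n : ℕ+) (u : ℝ) (x : ℕ → ℝ) {A : Set ℝ≥0}
    (hA : MeasurableSet A) :
    exceedanceMeasure n u x A =
      ({k : ℕ | (k : ℝ≥0) / ((n : ℕ) : ℝ≥0) ∈ A ∧ x k > u}.encard : ℝ≥0∞) := by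
  rw [exceedanceMeasure, Measure.map_apply measurable_from_top hA,
    Measure.restrict_apply MeasurableSet.of_discrete, Measure.count_apply MeasurableSet.of_discrete]
  rfl

theorem exceedanceMeasure_isLocallyFinite (n : ℕ+) (u : ℝ) (x : ℕ → ℝ) :
    IsLocallyFiniteMeasure (exceedanceMeasure n u x) := by
  refine ⟨fun t => ⟨Set.Iio (t + 1), Iio_mem_nhds (lt_add_one t), ?_⟩⟩
  rw [exceedanceMeasure_apply n u x measurableSet_Iio]
  have hfin : {k : ℕ | (k : ℝ≥0) / ((n : ℕ) : ℝ≥0) ∈ Set.Iio (t + 1) ∧ x k > u}.Finite := by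
    obtain ⟨M, hM⟩ := exists_nat_gt ((t + 1) * ((n : ℕ) : ℝ≥0))
    refine (Set.finite_lt_nat M).subset fun k hk => ?_
    have hn : (0 : ℝ≥0) < ((n : ℕ) : ℝ≥0) := by exact_mod_cast n.pos
    have h := (div_lt_iff₀ hn).1 hk.1
    exact_mod_cast h.trans hM
  rw [hfin.encard_eq_coe_toFinset_card]
  exact ENNReal.natCast_lt_top _

/-- The time-scaled point process of exceedances of the level `u` by the process `X`:
`N_n(A) = #{k / n ∈ A : X k > u}`. -/
noncomputable def exceedanceProcess {Ω : Type*} (X : ℕ → Ω → ℝ) (n : ℕ+) (u : ℝ) (ω : Ω) :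
    LocFinMeasure :=
  ⟨exceedanceMeasure n u fun k => X k ω, exceedanceMeasure_isLocallyFinite n u _⟩

/-- `N` is a (homogeneous) compound Poisson process on `[0, ∞)` with intensity `r` and
compounding law `G`: almost surely `N = ∑ i, ζ i • δ (T i)`, where
`T i = E 0 + ... + E i` are the points of a Poisson process of rate `r` (the gaps `E i` are i.i.d.
exponential with rate `r`), and the multiplicities `ζ i` are i.i.d. with law `G` and independent of
the points. -/
def IsCompoundPoissonProcess {Ω : Type*} [MeasurableSpace Ω] (N : Ω → LocFinMeasure)
    (r : ℝ) (G : PMF ℕ) (P : Measure Ω) : Prop :=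
  ∃ (E : ℕ → Ω → ℝ) (ζ : ℕ → Ω → ℕ),
    (∀ i, HasLaw (E i) (expMeasure r) P) ∧ iIndepFun E P ∧
    (∀ i, HasLaw (ζ i) G.toMeasure P) ∧ iIndepFun ζ P ∧
    IndepFun (fun ω i => E i ω) (fun ω i => ζ i ω) P ∧
    ∀ᵐ ω ∂P, (N ω).toMeasure = Measure.sum fun i : ℕ =>
      (ζ i ω : ℝ≥0∞) • Measure.dirac (∑ j ∈ Finset.range (i + 1), E j ω).toNNReal

/-!
The stationary sequence is a moving process driven by i.i.d. marks `(ζ i, U i)`, `i ∈ ℤ`, where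
`ζ i` has law `G` and `U i` is uniform on `(0, 1]`, independent of `ζ i`. Mark `i` starts a cluster
of height `1 / U i` on the integer interval of length `min (ζ i) ⌊(U i) ^ (-1/2)⌋` starting at `i`,
and `X k = -1 / H`, where `H` is the supremum of the heights of the clusters covering `k`; the
levels are `u n = -1 / n`. Hence `X k > u n` exactly when a cluster of height above `n` covers `k`.
Such clusters start at a given place with probability `1 / n`, so after rescaling time by `n` their
starting points form a rate one Poisson process in the limit. The truncation makes the heights
compatible with an infinite mean of `G`: a cluster of height `h` has length at most `√h`, so that
clusters started before time `0` reach time `0` with probability at most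
`∑ s, min (1 / n) (1 / (s + 1) ^ 2) → 0` (`tendsto_measure_oldClusterEvent`), while a cluster of
height above `n` has its full size `ζ` as soon as `n` is large (`eventually_conditionedLength_eq`).

Outside that event the exceedances are `clusterSet l`, where `l i` is the length of cluster `i` if
its height exceeds `n` and `0` otherwise, an i.i.d. sequence in `ℕ`. It has the law of a sequence
obtained by inserting geometric runs of zeros between i.i.d. lengths
(`map_insertZeros_infinitePi`); this follows from the memoryless property and the fact that an
i.i.d. law on sequences is the only one reproduced by adding an independent first term
(`eq_infinitePi_of_map_seqCons`). Taking the geometric runs to be discretised exponential variables,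
and using that `U` given `U < 1 / n` has the law of `U / n`, all levels are realised together with
the compound Poisson process on one space, where the point measures converge almost surely in the
vague topology (`tendsto_latticeMeasure_insertZeros`). Dominated convergence then gives convergence
in distribution.

Borel measurability for the vague topology is obtained by writing the random measures as continuous
functions of measurable sequences; for the limit this needs the additional discrete variables in
`countedGaps`.
-/

/-! ### Product measures on sequence spaces -/

/-- The sequence `a, y 0, y 1, …`. -/
def seqCons {α : Type*} (a : α) (y : ℕ → α) : ℕ → α
  | 0 => a
  | n + 1 => y n

@[simp] theorem seqCons_zero {α : Type*} (a : α) (y : ℕ → α) : seqCons a y 0 = a := rfl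

@[simp] theorem seqCons_succ {α : Type*} (a : α) (y : ℕ → α) (n : ℕ) :
    seqCons a y (n + 1) = y n := rfl

theorem measurable_seqCons {α : Type*} [MeasurableSpace α] :
    Measurable fun x : α × (ℕ → α) => seqCons x.1 x.2 := by
  refine measurable_pi_iff.2 fun n => ?_
  cases n with
  | zero => exact measurable_fst
  | succ n => exact (measurable_pi_apply n).comp measurable_snd

theorem measurableSet_forall_lt_mem {α : Type*} [MeasurableSpace α] {t : ℕ → Set α}
    (ht : ∀ i, MeasurableSet (t i)) (N : ℕ) : MeasurableSet {x : ℕ → α | ∀ i < N, x i ∈ t i} := by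
  have : {x : ℕ → α | ∀ i < N, x i ∈ t i} = Set.pi (Finset.range N : Set ℕ) t := by
    ext x; simp
  rw [this]
  exact .pi (Finset.countable_toSet _) fun i _ => ht i

theorem eq_infinitePi_of_forall_lt {α : Type*} [MeasurableSpace α] (μ : Measure α)
    [IsProbabilityMeasure μ] {Q : Measure (ℕ → α)}
    (h : ∀ (N : ℕ) (t : ℕ → Set α), (∀ i, MeasurableSet (t i)) →
      Q {x | ∀ i < N, x i ∈ t i} = ∏ i ∈ Finset.range N, μ (t i)) :
    Q = Measure.infinitePi fun _ => μ := by
  classical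
  refine Measure.eq_infinitePi _ fun s t ht => ?_
  obtain ⟨N, hN⟩ : ∃ N, s ⊆ Finset.range N := ⟨_, s.subset_range_sup_succ⟩
  have hset : Set.pi (s : Set ℕ) t =
      {x : ℕ → α | ∀ i < N, x i ∈ if i ∈ s then t i else Set.univ} := by
    ext x
    simp only [Set.mem_pi, Finset.mem_coe, Set.mem_ofPred_eq]
    refine ⟨fun hx i _ => ?_, fun hx i hi => ?_⟩
    · split_ifs with hi
      exacts [hx i hi, Set.mem_univ _]
    · simpa [hi] using hx i (Finset.mem_range.1 (hN hi))
  rw [hset, h N _ fun i => by split_ifs; exacts [ht i, .univ], ← Finset.prod_subset hN]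
  · exact Finset.prod_congr rfl fun i hi => by simp [hi]
  · intro i _ hi
    simp [hi]

theorem preimage_seqCons_forall_lt {α : Type*} (t : ℕ → Set α) (N : ℕ) :
    (fun x : α × (ℕ → α) => seqCons x.1 x.2) ⁻¹' {x | ∀ i < N + 1, x i ∈ t i} =
      t 0 ×ˢ {x | ∀ i < N, x i ∈ t (i + 1)} := by
  ext x
  simp only [Set.mem_preimage, Set.mem_ofPred_eq, Set.mem_prod, Nat.forall_lt_succ_left, seqCons_zero,
    seqCons_succ]

/-- An i.i.d. sequence is characterised by its self-similarity: a probability law on sequences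
which does not change when an independent `μ`-distributed first term is inserted is `μ^ℕ`. -/
theorem eq_infinitePi_of_map_seqCons {α : Type*} [MeasurableSpace α] (μ : Measure α)
    [IsProbabilityMeasure μ] {Q : Measure (ℕ → α)} [IsProbabilityMeasure Q]
    (h : (μ.prod Q).map (fun x => seqCons x.1 x.2) = Q) :
    Q = Measure.infinitePi fun _ => μ := by
  refine eq_infinitePi_of_forall_lt μ fun N => ?_
  induction N with
  | zero => intro t _; simp
  | succ N ih =>
    intro t ht
    rw [← h, Measure.map_apply measurable_seqCons (measurableSet_forall_lt_mem ht _),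
      preimage_seqCons_forall_lt, Measure.prod_prod, ih _ fun i => ht (i + 1),
      Finset.prod_range_succ', mul_comm]

theorem map_seqCons_infinitePi {α : Type*} [MeasurableSpace α] (μ : Measure α)
    [IsProbabilityMeasure μ] :
    (μ.prod (Measure.infinitePi fun _ : ℕ => μ)).map (fun x => seqCons x.1 x.2) =
      Measure.infinitePi fun _ : ℕ => μ := by
  refine eq_infinitePi_of_forall_lt μ fun N t ht => ?_
  rw [Measure.map_apply measurable_seqCons (measurableSet_forall_lt_mem ht _)]
  cases N with
  | zero => simp
  | succ N =>
    have : {x : ℕ → α | ∀ i < N, x i ∈ t (i + 1)} =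
        Set.pi (Finset.range N : Set ℕ) fun i => t (i + 1) := by ext x; simp
    rw [preimage_seqCons_forall_lt, Measure.prod_prod, this,
      Measure.infinitePi_pi _ fun i _ => ht (i + 1), Finset.prod_range_succ', mul_comm]

theorem isPiSystem_squareCylinders_measurableSet {γ : Type*} [MeasurableSpace γ] :
    IsPiSystem (squareCylinders fun _ : ℕ => {s : Set γ | MeasurableSet s}) :=
  isPiSystem_squareCylinders (fun _ => MeasurableSpace.isPiSystem_measurableSet) (by simp)

theorem comap_pi_eq_generateFrom {Ω γ : Type*} [MeasurableSpace γ] (g : Ω → ℕ → γ) :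
    MeasurableSpace.pi.comap g =
      MeasurableSpace.generateFrom {s | ∃ t ∈
        squareCylinders (fun _ : ℕ => {s : Set γ | MeasurableSet s}), g ⁻¹' t = s} := by
  rw [generateFrom_squareCylinders.symm, MeasurableSpace.comap_generateFrom]
  rfl

/-- The two coordinate processes of an i.i.d. sequence of independent pairs are independent. -/
theorem indepFun_fst_snd_infinitePi {α β : Type*} [MeasurableSpace α] [MeasurableSpace β]
    (μ : Measure α) (ν : Measure β) [IsProbabilityMeasure μ] [IsProbabilityMeasure ν] :
    IndepFun (fun (ω : ℕ → α × β) i => (ω i).1) (fun ω i => (ω i).2)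
      (Measure.infinitePi fun _ => μ.prod ν) := by
  classical
  refine IndepSets.indep (Measurable.comap_le (by fun_prop)) (Measurable.comap_le (by fun_prop))
    (IsPiSystem.comap isPiSystem_squareCylinders_measurableSet _)
    (IsPiSystem.comap isPiSystem_squareCylinders_measurableSet _)
    (comap_pi_eq_generateFrom _) (comap_pi_eq_generateFrom _) ?_
  rw [IndepSets_iff]
  rintro - - ⟨-, ⟨I, s, hs, rfl⟩, rfl⟩ ⟨-, ⟨J, t, ht, rfl⟩, rfl⟩
  simp only [Set.mem_pi, Set.mem_univ, Set.mem_ofPred_eq, forall_const] at hs ht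
  set P := Measure.infinitePi fun _ : ℕ => μ.prod ν
  -- Boxes over `I` and `J` are boxes over `I ∪ J` with trivial additional sides.
  let s' : ℕ → Set α := fun i => if i ∈ I then s i else Set.univ
  let t' : ℕ → Set β := fun i => if i ∈ J then t i else Set.univ
  have hs' : ∀ i, MeasurableSet (s' i) := fun i => by
    dsimp only [s']; split_ifs; exacts [hs i, .univ]
  have ht' : ∀ i, MeasurableSet (t' i) := fun i => by
    dsimp only [t']; split_ifs; exacts [ht i, .univ]
  have e1 : (fun (ω : ℕ → α × β) i => (ω i).1) ⁻¹' Set.pi (I : Set ℕ) s =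
      Set.pi ((I ∪ J : Finset ℕ) : Set ℕ) fun i => s' i ×ˢ (Set.univ : Set β) := by
    ext x; simp [s']; grind
  have e2 : (fun (ω : ℕ → α × β) i => (ω i).2) ⁻¹' Set.pi (J : Set ℕ) t =
      Set.pi ((I ∪ J : Finset ℕ) : Set ℕ) fun i => (Set.univ : Set α) ×ˢ t' i := by
    ext x; simp [t']; grind
  rw [e1, e2, ← Set.pi_inter_distrib,
    Measure.infinitePi_pi _ fun i _ => ((hs' i).prod .univ).inter (MeasurableSet.univ.prod (ht' i)),
    Measure.infinitePi_pi _ fun i _ => (hs' i).prod .univ,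
    Measure.infinitePi_pi _ fun i _ => MeasurableSet.univ.prod (ht' i), ← Finset.prod_mul_distrib]
  refine Finset.prod_congr rfl fun i _ => ?_
  rw [Set.prod_inter_prod]
  simp [Measure.prod_prod]

/-! ### Waiting times and marks of an i.i.d. sequence -/

/-- The sequence which is zero except for the marks `(y j).2`, where mark number `j` is preceded by
exactly `(y j).1` zeros after mark number `j - 1`. The recursion removes either a leading mark or a
leading zero. -/
def insertZeros : (ℕ → ℕ × ℕ) → ℕ → ℕ
  | y, 0 => if (y 0).1 = 0 then (y 0).2 else 0
  | y, i + 1 => if (y 0).1 = 0 then insertZeros (fun j => y (j + 1)) i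
      else insertZeros (seqCons ((y 0).1 - 1, (y 0).2) fun j => y (j + 1)) i

/-- The place of mark number `j` in `insertZeros y`. -/
def markIndex (y : ℕ → ℕ × ℕ) (j : ℕ) : ℕ :=
  ∑ i ∈ Finset.range j, ((y i).1 + 1) + (y j).1

theorem insertZeros_seqCons_zero (l : ℕ) (y : ℕ → ℕ × ℕ) :
    insertZeros (seqCons (0, l) y) = seqCons l (insertZeros y) := by
  funext i
  cases i <;> simp [insertZeros]

theorem insertZeros_seqCons_succ (g l : ℕ) (y : ℕ → ℕ × ℕ) :
    insertZeros (seqCons (g + 1, l) y) = seqCons 0 (insertZeros (seqCons (g, l) y)) := by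
  funext i
  cases i <;> simp [insertZeros]

theorem seqCons_head_tail {α : Type*} (y : ℕ → α) : seqCons (y 0) (fun j => y (j + 1)) = y := by
  funext i
  cases i <;> rfl

theorem markIndex_succ (y : ℕ → ℕ × ℕ) (j : ℕ) :
    markIndex y (j + 1) = markIndex y j + 1 + (y (j + 1)).1 := by
  simp only [markIndex, Finset.sum_range_succ]
  ring

theorem markIndex_seqCons_zero (l : ℕ) (y : ℕ → ℕ × ℕ) (j : ℕ) :
    markIndex (seqCons (0, l) y) (j + 1) = markIndex y j + 1 := by
  simp [markIndex, Finset.sum_range_succ']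
  ring

theorem markIndex_seqCons_succ (g l : ℕ) (y : ℕ → ℕ × ℕ) (j : ℕ) :
    markIndex (seqCons (g + 1, l) y) j = markIndex (seqCons (g, l) y) j + 1 := by
  cases j with
  | zero => simp [markIndex]
  | succ j =>
    simp [markIndex, Finset.sum_range_succ']
    ring

theorem lt_insertZeros_iff (y : ℕ → ℕ × ℕ) (i m : ℕ) :
    m < insertZeros y i ↔ ∃ j, markIndex y j = i ∧ m < (y j).2 := by
  induction i generalizing y with
  | zero =>
    rw [← seqCons_head_tail y]
    obtain ⟨g, l⟩ := y 0
    rcases g with _ | g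
    · rw [insertZeros_seqCons_zero]
      refine ⟨fun h => ⟨0, by simp [markIndex], h⟩, ?_⟩
      rintro ⟨_ | j, hj, h⟩
      · exact h
      · rw [markIndex_seqCons_zero] at hj; omega
    · rw [insertZeros_seqCons_succ]
      simp [markIndex_seqCons_succ]
  | succ i ih =>
    rw [← seqCons_head_tail y]
    obtain ⟨g, l⟩ := y 0
    rcases g with _ | g
    · rw [insertZeros_seqCons_zero, seqCons_succ, ih]
      constructor
      · rintro ⟨j, hj, h⟩
        exact ⟨j + 1, by rw [markIndex_seqCons_zero, hj], h⟩
      · rintro ⟨_ | j, hj, h⟩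
        · simp [markIndex] at hj
        · rw [markIndex_seqCons_zero] at hj
          exact ⟨j, by omega, h⟩
    · rw [insertZeros_seqCons_succ, seqCons_succ, ih]
      refine exists_congr fun j => ?_
      rw [markIndex_seqCons_succ]
      rcases j with _ | j <;> simp

theorem measurable_insertZeros : Measurable insertZeros := by
  refine measurable_pi_iff.2 fun i => ?_
  have h0 : MeasurableSet {y : ℕ → ℕ × ℕ | (y 0).1 = 0} :=
    (measurable_fst.comp (measurable_pi_apply 0)) (MeasurableSet.singleton 0)
  induction i with
  | zero => exact Measurable.ite h0 (by fun_prop) measurable_const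
  | succ i ih =>
    refine Measurable.ite h0 (ih.comp (by fun_prop)) (ih.comp ?_)
    refine measurable_seqCons.comp (f := fun y : ℕ → ℕ × ℕ =>
      (((y 0).1 - 1, (y 0).2), fun j => y (j + 1))) ?_
    fun_prop

/-- If the gaps are geometric, in the form of the memoryless identity `hγ`, then inserting the gaps
between i.i.d. marks yields an i.i.d. sequence. -/
theorem map_insertZeros_infinitePi (γ σ ρ : Measure ℕ) [IsProbabilityMeasure γ]
    [IsProbabilityMeasure σ] [IsProbabilityMeasure ρ] (p q : ℝ≥0∞)
    (hγ : γ = p • Measure.dirac 0 + q • γ.map Nat.succ)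
    (hρ : ρ = p • σ + q • Measure.dirac 0) :
    (Measure.infinitePi fun _ : ℕ => γ.prod σ).map insertZeros =
      Measure.infinitePi fun _ => ρ := by
  set K := Measure.infinitePi fun _ : ℕ => γ.prod σ with hK
  have : IsProbabilityMeasure (K.map insertZeros) :=
    Measure.isProbabilityMeasure_map measurable_insertZeros.aemeasurable
  refine eq_infinitePi_of_map_seqCons ρ ?_
  have hsucc : Measurable Nat.succ := measurable_from_top
  have hcons := measurable_seqCons (α := ℕ)
  have hconsP := measurable_seqCons (α := ℕ × ℕ)
  -- The law of `insertZeros`, with the first pair `(g, l)` split off.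
  have hself : ∀ A, MeasurableSet A → K.map insertZeros A =
      ∫⁻ g, ∫⁻ l, K {y | insertZeros (seqCons (g, l) y) ∈ A} ∂σ ∂γ := by
    intro A hA
    have hm := (measurable_insertZeros.comp hconsP) hA
    conv_lhs => rw [hK, ← map_seqCons_infinitePi, Measure.map_map measurable_insertZeros hconsP]
    rw [Measure.map_apply (measurable_insertZeros.comp hconsP) hA, Measure.prod_apply hm,
      lintegral_prod _ (measurable_measure_prodMk_left hm).aemeasurable]
    rfl
  refine Measure.ext fun A hA => ?_
  have hA' := hcons hA
  have hslice : ∀ l, MeasurableSet {z | seqCons l z ∈ A} := fun l => measurable_prodMk_left hA'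
  have hfst : ∀ l, K {y | insertZeros (seqCons (0, l) y) ∈ A} =
      K.map insertZeros {z | seqCons l z ∈ A} := by
    intro l
    rw [Measure.map_apply measurable_insertZeros (hslice l)]
    simp only [insertZeros_seqCons_zero]
    rfl
  have hzero : K.map insertZeros {z | seqCons 0 z ∈ A} =
      ∫⁻ g, ∫⁻ l, K {y | insertZeros (seqCons (g + 1, l) y) ∈ A} ∂σ ∂γ := by
    rw [hself _ (hslice 0)]
    simp only [insertZeros_seqCons_succ, Set.mem_ofPred_eq]
  conv_rhs => rw [hself A hA, hγ, lintegral_add_measure, lintegral_smul_measure,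
    lintegral_smul_measure, lintegral_dirac, lintegral_map measurable_from_top hsucc]
  have hprod : (ρ.prod (K.map insertZeros)).map (fun x => seqCons x.1 x.2) A =
      ∫⁻ l, K.map insertZeros {z | seqCons l z ∈ A} ∂ρ := by
    rw [Measure.map_apply hcons hA, Measure.prod_apply hA']
    rfl
  rw [hprod, hρ, lintegral_add_measure, lintegral_smul_measure,
    lintegral_smul_measure, lintegral_dirac, hzero]
  simp only [hfst, Nat.succ_eq_add_one]

/-! ### Vague convergence and lattice point measures -/

namespace LocFinMeasure

theorem tendsto_iff_integral {ι : Type*} {l : Filter ι} {μ : ι → LocFinMeasure}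
    {ν : LocFinMeasure} :
    Tendsto μ l (𝓝 ν) ↔ ∀ f : C_c(ℝ≥0, ℝ),
      Tendsto (fun i => ∫ x, f x ∂(μ i).toMeasure) l (𝓝 (∫ x, f x ∂ν.toMeasure)) := by
  rw [nhds_induced, tendsto_comap_iff, tendsto_pi_nhds]
  rfl

theorem continuous_iff_integral {α : Type*} [TopologicalSpace α] {μ : α → LocFinMeasure} :
    Continuous μ ↔ ∀ f : C_c(ℝ≥0, ℝ), Continuous fun a => ∫ x, f x ∂(μ a).toMeasure := by
  rw [continuous_induced_rng, continuous_pi_iff]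
  rfl

end LocFinMeasure

theorem exists_nat_forall_ge_eq_zero (f : C_c(ℝ≥0, ℝ)) :
    ∃ M : ℕ, ∀ x : ℝ≥0, (M : ℝ≥0) ≤ x → f x = 0 := by
  obtain ⟨b, hb⟩ := f.hasCompactSupport.isCompact.bddAbove
  obtain ⟨M, hM⟩ := exists_nat_gt b
  refine ⟨M, fun x hx => by_contra fun hne => ?_⟩
  exact absurd (hb (subset_tsupport _ hne)) (not_le.2 (hM.trans_le hx))

/-- The measure `∑ k ∈ B, δ (k / n)`. -/
noncomputable def latticeMeasure (n : ℕ+) (B : Set ℕ) : LocFinMeasure where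
  toMeasure := (Measure.count.restrict B).map fun k : ℕ => (k : ℝ≥0) / ((n : ℕ) : ℝ≥0)
  locallyFinite := by
    have h := exceedanceMeasure_isLocallyFinite n 0 (B.indicator 1)
    have hB : {k : ℕ | (0 : ℝ) < B.indicator 1 k} = B := by
      ext k
      by_cases hk : k ∈ B <;> simp [hk]
    rwa [exceedanceMeasure, hB] at h

theorem exceedanceProcess_eq_latticeMeasure {Ω : Type*} (X : ℕ → Ω → ℝ) (n : ℕ+) (u : ℝ) (ω : Ω) :
    exceedanceProcess X n u ω = latticeMeasure n {k | u < X k ω} := rfl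

theorem integral_latticeMeasure (n : ℕ+) (B : Set ℕ) (f : C_c(ℝ≥0, ℝ)) :
    ∫ x, f x ∂(latticeMeasure n B).toMeasure =
      ∑' k : ℕ, B.indicator (fun k : ℕ => f ((k : ℝ≥0) / ((n : ℕ) : ℝ≥0))) k := by
  have hc : (Measure.count : Measure ℕ) =
      Measure.sum fun k : ℕ => (1 : ℝ≥0∞) • Measure.dirac (id k) := by
    simp [Measure.count]
  rw [latticeMeasure, integral_map measurable_from_top.aemeasurable
    (map_continuous f).aestronglyMeasurable, ← integral_indicator MeasurableSet.of_discrete, hc,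
    integral_sum_dirac fun _ => ENNReal.one_ne_top]
  simp

theorem integral_latticeMeasure_eq_sum (n : ℕ+) (B : Set ℕ) (f : C_c(ℝ≥0, ℝ)) (s : Finset ℕ)
    (hs : ∀ k ∈ B, k ∉ s → f ((k : ℝ≥0) / ((n : ℕ) : ℝ≥0)) = 0) :
    ∫ x, f x ∂(latticeMeasure n B).toMeasure =
      ∑ k ∈ s, B.indicator (fun k : ℕ => f ((k : ℝ≥0) / ((n : ℕ) : ℝ≥0))) k := by
  rw [integral_latticeMeasure]
  refine tsum_eq_sum fun k hk => ?_
  by_cases hB : k ∈ B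
  · rw [Set.indicator_of_mem hB, hs k hB hk]
  · exact Set.indicator_of_notMem hB _

theorem le_div_of_mul_le {M k : ℕ} {n : ℕ+} (h : M * n ≤ k) :
    (M : ℝ≥0) ≤ (k : ℝ≥0) / ((n : ℕ) : ℝ≥0) := by
  rw [le_div_iff₀ (by exact_mod_cast n.pos)]
  exact_mod_cast h

/-- The set covered by the integer intervals `[i, i + l i)`. -/
def clusterSet (l : ℕ → ℕ) : Set ℕ := {k | ∃ s ≤ k, s < l (k - s)}

theorem isClopen_setOf_mem_clusterSet (k : ℕ) : IsClopen {l : ℕ → ℕ | k ∈ clusterSet l} := by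
  have : {l : ℕ → ℕ | k ∈ clusterSet l} =
      ⋃ s ∈ Finset.range (k + 1), (fun l : ℕ → ℕ => l (k - s)) ⁻¹' Set.Ioi s := by
    ext l
    simp [clusterSet]
  rw [this]
  exact isClopen_biUnion_finset fun s _ => (isClopen_discrete _).preimage (continuous_apply _)

theorem continuous_latticeMeasure_clusterSet (n : ℕ+) :
    Continuous fun l : ℕ → ℕ => latticeMeasure n (clusterSet l) := by
  refine LocFinMeasure.continuous_iff_integral.2 fun f => ?_
  obtain ⟨M, hM⟩ := exists_nat_forall_ge_eq_zero f
  have : (fun l => ∫ x, f x ∂(latticeMeasure n (clusterSet l)).toMeasure) = fun l =>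
      ∑ k ∈ Finset.range (M * n), {l : ℕ → ℕ | k ∈ clusterSet l}.indicator
        (fun _ => f ((k : ℝ≥0) / ((n : ℕ) : ℝ≥0))) l := by
    funext l
    rw [integral_latticeMeasure_eq_sum n _ f (Finset.range (M * n)) fun k _ hk =>
      hM _ (le_div_of_mul_le (by simpa using hk))]
    rfl
  rw [this]
  exact continuous_finsetSum _ fun k _ =>
    (isClopen_setOf_mem_clusterSet k).continuous_indicator continuous_const

theorem continuous_latticeMeasure_setOf (n : ℕ+) :
    Continuous fun b : ℕ → Bool => latticeMeasure n {k | b k = true} := by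
  refine LocFinMeasure.continuous_iff_integral.2 fun f => ?_
  obtain ⟨M, hM⟩ := exists_nat_forall_ge_eq_zero f
  have : (fun b : ℕ → Bool => ∫ x, f x ∂(latticeMeasure n {k | b k = true}).toMeasure) = fun b =>
      ∑ k ∈ Finset.range (M * n), {b : ℕ → Bool | b k = true}.indicator
        (fun _ => f ((k : ℝ≥0) / ((n : ℕ) : ℝ≥0))) b := by
    funext b
    rw [integral_latticeMeasure_eq_sum n _ f (Finset.range (M * n)) fun k _ hk =>
      hM _ (le_div_of_mul_le (by simpa using hk))]
    rfl
  rw [this]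
  refine continuous_finsetSum _ fun k _ => IsClopen.continuous_indicator ?_ continuous_const
  exact (isClopen_discrete {true}).preimage (continuous_apply k)

theorem measurable_exceedanceProcess {Ω : Type*} [MeasurableSpace Ω] {X : ℕ → Ω → ℝ}
    (hX : ∀ k, Measurable (X k)) (n : ℕ+) (u : ℝ) : Measurable (exceedanceProcess X n u) := by
  classical
  have hb : Measurable fun ω k => decide (u < X k ω) := by
    refine measurable_pi_iff.2 fun k => measurable_to_bool ?_
    have : (fun ω => decide (u < X k ω)) ⁻¹' {true} = {ω | u < X k ω} := by ext; simp
    rw [this]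
    exact measurableSet_lt measurable_const (hX k)
  have h : exceedanceProcess X n u =
      (fun b : ℕ → Bool => latticeMeasure n {k | b k = true}) ∘ fun ω k => decide (u < X k ω) := by
    funext ω
    simp only [Function.comp_apply, decide_eq_true_eq]
    rfl
  rw [h]
  exact (continuous_latticeMeasure_setOf n).measurable.comp hb

/-! ### Compound point measures -/

/-- The position of point number `j` when the successive gaps are `e`. -/
def pointTime (e : ℕ → ℝ) (j : ℕ) : ℝ := ∑ i ∈ Finset.range (j + 1), e i

open Classical in
/-- The measure `∑ j, z j • δ (T j)`, where `T j = e 0 + ⋯ + e j`; it is set to zero when `T j` does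
not tend to infinity, as the sum might then fail to be locally finite. -/
noncomputable def compoundMeasure (e : ℕ → ℝ) (z : ℕ → ℕ) : LocFinMeasure where
  toMeasure := if Tendsto (pointTime e) atTop atTop then
    Measure.sum fun j => (z j : ℝ≥0∞) • Measure.dirac (pointTime e j).toNNReal else 0
  locallyFinite := by
    split_ifs with h
    · refine ⟨fun x => ⟨Set.Iio (x + 1), Iio_mem_nhds (lt_add_one x), ?_⟩⟩
      obtain ⟨J, hJ⟩ := eventually_atTop.1 (h.eventually_ge_atTop ((x + 1 : ℝ≥0) : ℝ))
      rw [Measure.sum_apply _ measurableSet_Iio, tsum_eq_sum (s := Finset.range J)]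
      · refine ENNReal.sum_lt_top.2 fun j _ => ?_
        rw [Measure.smul_apply, smul_eq_mul]
        exact ENNReal.mul_lt_top (ENNReal.natCast_lt_top _) (measure_lt_top _ _)
      · intro j hj
        have hle : x + 1 ≤ (pointTime e j).toNNReal :=
          NNReal.le_toNNReal_of_coe_le (hJ j (by simpa using hj))
        simp only [Measure.smul_apply, Measure.dirac_apply' _ measurableSet_Iio, smul_eq_mul]
        rw [Set.indicator_of_notMem (by simpa using hle), mul_zero]
    · infer_instance

theorem integral_compoundMeasure {e : ℕ → ℝ} (z : ℕ → ℕ) (h : Tendsto (pointTime e) atTop atTop)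
    (f : C_c(ℝ≥0, ℝ)) {M J : ℕ} (hM : ∀ x : ℝ≥0, (M : ℝ≥0) ≤ x → f x = 0)
    (hJ : ∀ j ≥ J, (M : ℝ) ≤ pointTime e j) :
    ∫ x, f x ∂(compoundMeasure e z).toMeasure =
      ∑ j ∈ Finset.range J, (z j : ℝ) * f (pointTime e j).toNNReal := by
  simp only [compoundMeasure, if_pos h]
  rw [integral_sum_dirac fun _ => ENNReal.natCast_ne_top _]
  simp only [ENNReal.toReal_natCast, smul_eq_mul]
  refine tsum_eq_sum fun j hj => ?_
  rw [hM _ (NNReal.le_toNNReal_of_coe_le (by simpa using hJ j (by simpa using hj))), mul_zero]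

/-- Gaps, multiplicities, and a sequence `c` such that all points from number `c m` on lie in
`[m, ∞)`. Carrying `c` along as a discrete variable makes the compound measure depend continuously
on the data. -/
def countedGaps : Set ((ℕ → ℝ) × (ℕ → ℕ) × (ℕ → ℕ)) :=
  {y | ∀ m, ∀ j ≥ y.2.2 m, (m : ℝ) ≤ pointTime y.1 j}

theorem tendsto_pointTime_of_mem_countedGaps {y : (ℕ → ℝ) × (ℕ → ℕ) × (ℕ → ℕ)}
    (hy : y ∈ countedGaps) : Tendsto (pointTime y.1) atTop atTop := by
  refine tendsto_atTop.2 fun b => ?_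
  obtain ⟨m, hm⟩ := exists_nat_ge b
  exact eventually_atTop.2 ⟨y.2.2 m, fun j hj => hm.trans (hy m j hj)⟩

theorem continuous_compoundMeasure :
    Continuous fun y : countedGaps => compoundMeasure y.1.1 y.1.2.1 := by
  refine LocFinMeasure.continuous_iff_integral.2 fun f => ?_
  obtain ⟨M, hM⟩ := exists_nat_forall_ge_eq_zero f
  have hint : ∀ y : countedGaps, ∫ x, f x ∂(compoundMeasure y.1.1 y.1.2.1).toMeasure =
      ∑ j ∈ Finset.range (y.1.2.2 M), (y.1.2.1 j : ℝ) * f (pointTime y.1.1 j).toNNReal :=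
    fun y => integral_compoundMeasure _ (tendsto_pointTime_of_mem_countedGaps y.2) f hM (y.2 M)
  simp only [hint]
  refine continuous_iff_continuousAt.2 fun y₀ => ?_
  have hloc : ∀ᶠ y : countedGaps in 𝓝 y₀, y.1.2.2 M = y₀.1.2.2 M := by
    have hc : Continuous fun y : countedGaps => y.1.2.2 M := by fun_prop
    exact hc.continuousAt.eventually_mem ((isOpen_discrete {y₀.1.2.2 M}).mem_nhds rfl)
  have hsum : Continuous fun y : countedGaps =>
      ∑ j ∈ Finset.range (y₀.1.2.2 M), (y.1.2.1 j : ℝ) * f (pointTime y.1.1 j).toNNReal := by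
    refine continuous_finsetSum _ fun j _ => Continuous.mul ?_ (f.continuous.comp ?_)
    · exact (continuous_of_discreteTopology (f := fun n : ℕ => (n : ℝ))).comp (by fun_prop)
    · unfold pointTime
      fun_prop
  exact hsum.continuousAt.congr (hloc.mono fun y hy => by simp only [hy])

theorem measurable_compoundMeasure {Ω : Type*} [MeasurableSpace Ω] {e : Ω → ℕ → ℝ} {z : Ω → ℕ → ℕ}
    (he : Measurable e) (hz : Measurable z)
    (h : ∀ ω, Tendsto (pointTime (e ω)) atTop atTop) :
    Measurable fun ω => compoundMeasure (e ω) (z ω) := by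
  classical
  have hex : ∀ (m : ℕ) (ω : Ω), ∃ J, ∀ j ≥ J, (m : ℝ) ≤ pointTime (e ω) j := fun m ω =>
    eventually_atTop.1 ((h ω).eventually_ge_atTop (m : ℝ))
  have hT : ∀ j, Measurable fun ω => pointTime (e ω) j := by
    intro j
    unfold pointTime
    fun_prop
  obtain ⟨c, hcm, hc⟩ : ∃ c : Ω → ℕ → ℕ, Measurable c ∧
      ∀ ω m, ∀ j ≥ c ω m, (m : ℝ) ≤ pointTime (e ω) j := by
    refine ⟨fun ω m => Nat.find (hex m ω), measurable_pi_iff.2 fun m => measurable_find _ fun J => ?_,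
      fun ω m => Nat.find_spec (hex m ω)⟩
    simp only [Set.ofPred_forall]
    exact .iInter fun j => .iInter fun _ => measurableSet_le measurable_const (hT j)
  have hy : Measurable fun ω => (⟨(e ω, z ω, c ω), hc ω⟩ : countedGaps) :=
    (he.prodMk (hz.prodMk hcm)).subtype_mk
  have hcomp := continuous_compoundMeasure.measurable.comp hy
  rw [Function.comp_def] at hcomp
  exact hcomp

theorem tendsto_pointTime_one : Tendsto (pointTime fun _ => 1) atTop atTop := by
  have : pointTime (fun _ => 1) = fun j : ℕ => ((j : ℝ) + 1) := by
    funext j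
    simp [pointTime]
  rw [this]
  exact tendsto_atTop_add_const_right _ _ tendsto_natCast_atTop_atTop

theorem aemeasurable_compoundMeasure {Ω : Type*} [MeasurableSpace Ω] {P : Measure Ω}
    {e : Ω → ℕ → ℝ} {z : Ω → ℕ → ℕ} (he : Measurable e) (hz : Measurable z)
    (h : ∀ᵐ ω ∂P, Tendsto (pointTime (e ω)) atTop atTop) :
    AEMeasurable (fun ω => compoundMeasure (e ω) (z ω)) P := by
  classical
  have hT : ∀ j, Measurable fun ω => pointTime (e ω) j := by
    intro j
    unfold pointTime
    fun_prop
  have hS : MeasurableSet {ω | Tendsto (pointTime (e ω)) atTop atTop} :=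
    measurableSet_tendsto _ hT
  refine ⟨fun ω => compoundMeasure
    (if Tendsto (pointTime (e ω)) atTop atTop then e ω else fun _ => 1) (z ω),
    measurable_compoundMeasure (Measurable.ite hS he measurable_const) hz fun ω => ?_, ?_⟩
  · split_ifs with hω
    exacts [hω, tendsto_pointTime_one]
  · filter_upwards [h] with ω hω
    rw [if_pos hω]

/-! ### Convergence of the cluster measures along a path -/

theorem mem_clusterSet_insertZeros {y : ℕ → ℕ × ℕ} {k : ℕ} :
    k ∈ clusterSet (insertZeros y) ↔ ∃ j s, s < (y j).2 ∧ markIndex y j + s = k := by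
  simp only [clusterSet, Set.mem_ofPred_eq, lt_insertZeros_iff]
  constructor
  · rintro ⟨s, hs, j, hj, h⟩
    exact ⟨j, s, h, by omega⟩
  · rintro ⟨j, s, h, rfl⟩
    exact ⟨s, by omega, j, by omega, h⟩

theorem markIndex_strictMono (y : ℕ → ℕ × ℕ) : StrictMono (markIndex y) :=
  strictMono_nat_of_lt_succ fun j => by rw [markIndex_succ]; omega

/-- If the first `J` clusters do not overlap and all later ones lie beyond the support of `f`, the
integral of `f` is a sum over the first `J` clusters. -/
theorem integral_latticeMeasure_insertZeros {y : ℕ → ℕ × ℕ} {z : ℕ → ℕ} {n : ℕ+}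
    (f : C_c(ℝ≥0, ℝ)) {M J : ℕ} (hM : ∀ x : ℝ≥0, (M : ℝ≥0) ≤ x → f x = 0)
    (hJ : M * n ≤ markIndex y J) (hz : ∀ j < J, (y j).2 = z j)
    (hgap : ∀ j < J, z j ≤ (y (j + 1)).1) :
    ∫ x, f x ∂(latticeMeasure n (clusterSet (insertZeros y))).toMeasure =
      ∑ j ∈ Finset.range J, ∑ s ∈ Finset.range (z j),
        f (((markIndex y j + s : ℕ) : ℝ≥0) / ((n : ℕ) : ℝ≥0)) := by
  classical
  have hlt : ∀ i j s, i < j → i < J → s < z i → markIndex y i + s < markIndex y j := by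
    intro i j s hij hi hs
    have h1 := (markIndex_strictMono y).monotone (Nat.succ_le_of_lt hij)
    have h2 := hgap i hi
    rw [Nat.succ_eq_add_one, markIndex_succ] at h1
    omega
  have hinj : Set.InjOn (fun x : (_ : ℕ) × ℕ => markIndex y x.1 + x.2)
      ((Finset.range J).sigma fun j => Finset.range (z j)) := by
    rintro ⟨i, s⟩ hi ⟨j, t⟩ hj h
    simp only [Finset.coe_sigma, Finset.coe_range, Set.mem_sigma_iff, Set.mem_Iio] at hi hj h
    rcases lt_trichotomy i j with hij | rfl | hij
    · have := hlt i j s hij hi.1 hi.2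
      omega
    · have : s = t := by omega
      rw [this]
    · have := hlt j i t hij hj.1 hj.2
      omega
  rw [integral_latticeMeasure_eq_sum n _ f
    (((Finset.range J).sigma fun j => Finset.range (z j)).image
      fun x => markIndex y x.1 + x.2), Finset.sum_image hinj, Finset.sum_sigma]
  · refine Finset.sum_congr rfl fun j hj => Finset.sum_congr rfl fun s hs => ?_
    refine Set.indicator_of_mem (mem_clusterSet_insertZeros.2 ⟨j, s, ?_, rfl⟩) _
    rw [hz j (Finset.mem_range.1 hj)]
    exact Finset.mem_range.1 hs
  · intro k hk hks
    obtain ⟨j, s, hs, rfl⟩ := mem_clusterSet_insertZeros.1 hk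
    refine hM _ (le_div_of_mul_le ?_)
    by_cases hj : j < J
    · refine (hks (Finset.mem_image.2 ⟨⟨j, s⟩, ?_, rfl⟩)).elim
      rw [hz j hj] at hs
      simp [hj, hs]
    · have := (markIndex_strictMono y).monotone (not_lt.1 hj)
      omega

theorem tendsto_pnat_cast_atTop : Tendsto (fun n : ℕ+ => ((n : ℕ) : ℝ)) atTop atTop :=
  tendsto_natCast_atTop_atTop.comp tendsto_PNat_val_atTop_atTop

theorem tendsto_markIndex_div {y : ℕ+ → ℕ → ℕ × ℕ} {e : ℕ → ℝ}
    (hg : ∀ j, Tendsto (fun n : ℕ+ => ((y n j).1 : ℝ) / ((n : ℕ) : ℝ)) atTop (𝓝 (e j))) (j : ℕ) :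
    Tendsto (fun n : ℕ+ => (markIndex (y n) j : ℝ) / ((n : ℕ) : ℝ)) atTop
      (𝓝 (pointTime e j)) := by
  have h1 : Tendsto (fun n : ℕ+ => (1 : ℝ) / ((n : ℕ) : ℝ)) atTop (𝓝 0) :=
    tendsto_const_nhds.div_atTop tendsto_pnat_cast_atTop
  have h : Tendsto (fun n : ℕ+ => ∑ i ∈ Finset.range j,
      (((y n i).1 : ℝ) / ((n : ℕ) : ℝ) + 1 / ((n : ℕ) : ℝ)) + ((y n j).1 : ℝ) / ((n : ℕ) : ℝ)) atTop
      (𝓝 (∑ i ∈ Finset.range j, (e i + 0) + e j)) :=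
    (tendsto_finsetSum _ fun i _ => (hg i).add h1).add (hg j)
  rw [pointTime, Finset.sum_range_succ]
  simp only [add_zero] at h
  refine h.congr fun n => ?_
  simp only [markIndex, Nat.cast_add, Nat.cast_sum, Nat.cast_one, add_div, Finset.sum_div]

theorem tendsto_latticeMeasure_insertZeros {y : ℕ+ → ℕ → ℕ × ℕ} {e : ℕ → ℝ} {z : ℕ → ℕ}
    (he : ∀ j, 0 < e j) (hT : Tendsto (pointTime e) atTop atTop)
    (hg : ∀ j, Tendsto (fun n : ℕ+ => ((y n j).1 : ℝ) / ((n : ℕ) : ℝ)) atTop (𝓝 (e j)))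
    (hz : ∀ j, ∀ᶠ n in atTop, (y n j).2 = z j) :
    Tendsto (fun n => latticeMeasure n (clusterSet (insertZeros (y n)))) atTop
      (𝓝 (compoundMeasure e z)) := by
  refine LocFinMeasure.tendsto_iff_integral.2 fun f => ?_
  obtain ⟨M, hM⟩ := exists_nat_forall_ge_eq_zero f
  obtain ⟨J, hJ⟩ := eventually_atTop.1 (hT.eventually_ge_atTop ((M : ℝ) + 1))
  rw [integral_compoundMeasure z hT f hM fun j hj => by linarith [hJ j hj]]
  have hpos : ∀ᶠ n : ℕ+ in atTop, M * n ≤ markIndex (y n) J := by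
    filter_upwards [(tendsto_markIndex_div hg J).eventually_const_lt
      (show (M : ℝ) < pointTime e J by linarith [hJ J le_rfl])] with n hn
    rw [lt_div_iff₀ (by exact_mod_cast n.pos)] at hn
    exact_mod_cast hn.le
  have hz' : ∀ᶠ n in atTop, ∀ j < J, (y n j).2 = z j :=
    (Set.finite_lt_nat J).eventually_all.2 fun j _ => hz j
  have hgap : ∀ᶠ n in atTop, ∀ j < J, z j ≤ (y n (j + 1)).1 := by
    refine (Set.finite_lt_nat J).eventually_all.2 fun j _ => ?_
    have h := (hg (j + 1)).pos_mul_atTop (he (j + 1)) tendsto_pnat_cast_atTop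
    filter_upwards [h.eventually_ge_atTop (z j : ℝ)] with n hn
    rw [div_mul_cancel₀ _ (by exact_mod_cast n.pos.ne')] at hn
    exact_mod_cast hn
  have hlim : Tendsto (fun n : ℕ+ => ∑ j ∈ Finset.range J, ∑ s ∈ Finset.range (z j),
      f (((markIndex (y n) j + s : ℕ) : ℝ≥0) / ((n : ℕ) : ℝ≥0))) atTop
      (𝓝 (∑ j ∈ Finset.range J, ∑ s ∈ Finset.range (z j), f (pointTime e j).toNNReal)) := by
    refine tendsto_finsetSum _ fun j _ => tendsto_finsetSum _ fun s _ => ?_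
    refine ((map_continuous f).tendsto _).comp ?_
    have h0 : Tendsto (fun n : ℕ+ => (s : ℝ) / ((n : ℕ) : ℝ)) atTop (𝓝 0) :=
      tendsto_const_nhds.div_atTop tendsto_pnat_cast_atTop
    have h := (continuous_real_toNNReal.tendsto _).comp ((tendsto_markIndex_div hg j).add h0)
    rw [add_zero] at h
    refine h.congr fun n => ?_
    rw [Function.comp_apply, ← add_div, Real.toNNReal_div (by positivity), ← Nat.cast_add,
      Real.toNNReal_natCast, Real.toNNReal_natCast]
  simp only [Finset.sum_const, Finset.card_range, nsmul_eq_mul] at hlim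
  refine hlim.congr' ?_
  filter_upwards [hpos, hz', hgap] with n h1 h2 h3
  exact (integral_latticeMeasure_insertZeros f hM h1 h2 h3).symm

/-! ### Geometric gaps from exponential gaps -/

instance : IsProbabilityMeasure (expMeasure 1) := isProbabilityMeasure_expMeasure one_pos

theorem expMeasure_one_Iic (x : ℝ) :
    expMeasure 1 (Set.Iic x) = ENNReal.ofReal (if 0 ≤ x then 1 - Real.exp (-x) else 0) := by
  rw [← ofReal_cdf, cdf_expMeasure_eq one_pos, one_mul]

/-- The number of whole periods `c` strictly before time `x`. When `x` is exponential this is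
geometric. -/
noncomputable def periodsBefore (c x : ℝ) : ℕ := ⌈x / c⌉₊ - 1

theorem measurable_periodsBefore (c : ℝ) : Measurable (periodsBefore c) :=
  (measurable_from_top (f := fun k : ℕ => k - 1)).comp
    (Nat.measurable_ceil.comp (measurable_id.div_const c))

theorem map_periodsBefore_Iic {c : ℝ} (hc : 0 < c) (k : ℕ) :
    (expMeasure 1).map (periodsBefore c) (Set.Iic k) =
      ENNReal.ofReal (1 - Real.exp (-c) ^ (k + 1)) := by
  have hset : periodsBefore c ⁻¹' Set.Iic k = Set.Iic ((k + 1 : ℕ) * c) := by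
    ext x
    rw [Set.mem_preimage, Set.mem_Iic, periodsBefore, Nat.sub_le_iff_le_add, Nat.ceil_le,
      div_le_iff₀ hc, Set.mem_Iic]
  rw [Measure.map_apply (measurable_periodsBefore c) measurableSet_Iic, hset, expMeasure_one_Iic,
    if_pos (by positivity), ← mul_neg, Real.exp_nat_mul]

/-- The memoryless property of the geometric law. -/
theorem map_periodsBefore_eq {c : ℝ} (hc : 0 < c) :
    (expMeasure 1).map (periodsBefore c) =
      ENNReal.ofReal (1 - Real.exp (-c)) • Measure.dirac 0 +
        ENNReal.ofReal (Real.exp (-c)) • ((expMeasure 1).map (periodsBefore c)).map Nat.succ := by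
  have : IsProbabilityMeasure ((expMeasure 1).map (periodsBefore c)) :=
    Measure.isProbabilityMeasure_map (measurable_periodsBefore c).aemeasurable
  have hq : Real.exp (-c) ≤ 1 := Real.exp_le_one_iff.2 (by linarith)
  refine Measure.ext_of_Iic _ _ fun k => ?_
  rw [map_periodsBefore_Iic hc, Measure.add_apply, Measure.smul_apply, Measure.smul_apply,
    Measure.dirac_apply' _ measurableSet_Iic, Measure.map_apply measurable_from_top
    measurableSet_Iic, Set.indicator_of_mem (by simp)]
  cases k with
  | zero =>
    have : Nat.succ ⁻¹' Set.Iic 0 = ∅ := by ext; simp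
    simp [this]
  | succ k =>
    have : Nat.succ ⁻¹' Set.Iic (k + 1) = Set.Iic k := by ext; simp
    rw [this, map_periodsBefore_Iic hc, Pi.one_apply, smul_eq_mul, smul_eq_mul, mul_one,
      ← ENNReal.ofReal_mul (Real.exp_pos _).le, ← ENNReal.ofReal_add (by linarith)]
    · congr 1
      ring
    · exact mul_nonneg (Real.exp_pos _).le
        (sub_nonneg.2 (pow_le_one₀ (Real.exp_pos _).le hq))

/-- The period for which an exponential gap is turned into a geometric gap with success
probability `1 / n`. -/
noncomputable def levelPeriod (n : ℕ+) : ℝ := -Real.log (1 - 1 / ((n : ℕ) : ℝ))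

theorem one_div_pnat_lt_one {n : ℕ+} (hn : 2 ≤ n) : 1 / ((n : ℕ) : ℝ) < 1 := by
  have h : (2 : ℝ) ≤ ((n : ℕ) : ℝ) := by exact_mod_cast hn
  rw [div_lt_one (by linarith)]
  linarith

theorem levelPeriod_pos {n : ℕ+} (hn : 2 ≤ n) : 0 < levelPeriod n := by
  have h := one_div_pnat_lt_one hn
  have h0 : 0 < 1 / ((n : ℕ) : ℝ) := one_div_pos.2 (by exact_mod_cast n.pos)
  exact neg_pos.2 (Real.log_neg (by linarith) (by linarith))

theorem exp_neg_levelPeriod {n : ℕ+} (hn : 2 ≤ n) :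
    Real.exp (-levelPeriod n) = 1 - 1 / ((n : ℕ) : ℝ) := by
  rw [levelPeriod, neg_neg, Real.exp_log]
  linarith [one_div_pnat_lt_one hn]

theorem tendsto_mul_levelPeriod :
    Tendsto (fun n : ℕ+ => ((n : ℕ) : ℝ) * levelPeriod n) atTop (𝓝 1) := by
  have h := ((Real.tendsto_mul_log_one_add_div_atTop (-1)).comp tendsto_pnat_cast_atTop).neg
  rw [neg_neg] at h
  refine h.congr fun n => ?_
  simp only [Function.comp_apply, levelPeriod]
  rw [mul_neg, neg_div, sub_eq_add_neg]

theorem tendsto_periodsBefore_div {x : ℝ} (hx : 0 < x) :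
    Tendsto (fun n : ℕ+ => (periodsBefore (levelPeriod n) x : ℝ) / ((n : ℕ) : ℝ)) atTop (𝓝 x) := by
  have hn : Tendsto (fun n : ℕ+ => (1 : ℝ) / ((n : ℕ) : ℝ)) atTop (𝓝 0) :=
    tendsto_const_nhds.div_atTop tendsto_pnat_cast_atTop
  have hup : Tendsto (fun n : ℕ+ => x / (((n : ℕ) : ℝ) * levelPeriod n)) atTop (𝓝 x) := by
    have h := (tendsto_const_nhds (x := x)).div tendsto_mul_levelPeriod one_ne_zero
    rw [div_one] at h
    exact h
  have hlow : Tendsto (fun n : ℕ+ => x / (((n : ℕ) : ℝ) * levelPeriod n) - 1 / ((n : ℕ) : ℝ))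
      atTop (𝓝 x) := by simpa using hup.sub hn
  have hcast : ∀ n : ℕ+, 2 ≤ n →
      x / levelPeriod n - 1 ≤ periodsBefore (levelPeriod n) x ∧
        (periodsBefore (levelPeriod n) x : ℝ) ≤ x / levelPeriod n := by
    intro n hn
    have hpos : 0 < x / levelPeriod n := div_pos hx (levelPeriod_pos hn)
    have h1 : 1 ≤ ⌈x / levelPeriod n⌉₊ := Nat.one_le_iff_ne_zero.2 (Nat.ceil_pos.2 hpos).ne'
    rw [periodsBefore, Nat.cast_sub h1, Nat.cast_one]
    exact ⟨by linarith [Nat.le_ceil (x / levelPeriod n)],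
      by linarith [Nat.ceil_lt_add_one hpos.le]⟩
  refine tendsto_of_tendsto_of_tendsto_of_le_of_le' hlow hup ?_ ?_
  · filter_upwards [eventually_ge_atTop 2] with n hn
    rw [mul_comm, ← div_div, ← sub_div]
    exact div_le_div_of_nonneg_right (hcast n hn).1 (by positivity)
  · filter_upwards [eventually_ge_atTop 2] with n hn
    rw [mul_comm, ← div_div]
    exact div_le_div_of_nonneg_right (hcast n hn).2 (by positivity)

/-! ### Marks and truncated cluster lengths -/

/-- The uniform law on `(0, 1]`. -/
noncomputable def unifMeasure : Measure ℝ := volume.restrict (Set.Ioc 0 1)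

instance : IsProbabilityMeasure unifMeasure := ⟨by simp [unifMeasure]⟩

/-- The law of a mark `(ζ, U)`: a cluster size `ζ` with law `G` and an independent uniform variable
`U`, where `1 / U` is the height of the cluster. -/
noncomputable def markMeasure (G : PMF ℕ) : Measure (ℕ × ℝ) := G.toMeasure.prod unifMeasure

instance (G : PMF ℕ) : IsProbabilityMeasure (markMeasure G) := by
  unfold markMeasure; infer_instance

/-- The length of the cluster with mark `(ζ, u)`: the size `ζ`, truncated at `u ^ (-1/2)`. -/
noncomputable def clusterLength (a : ℕ × ℝ) : ℕ := min a.1 ⌊(√a.2)⁻¹⌋₊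

/-- The length of the part of the cluster above level `n`: the whole cluster if its height exceeds
`n`, and nothing otherwise. -/
noncomputable def levelLength (n : ℕ+) (a : ℕ × ℝ) : ℕ :=
  if |a.2| < 1 / ((n : ℕ) : ℝ) then clusterLength a else 0

/-- The length of a cluster given that its height exceeds `n`; given this, `U` has the law of
`U / n`. -/
noncomputable def conditionedLength (n : ℕ+) (a : ℕ × ℝ) : ℕ :=
  clusterLength (a.1, a.2 * (1 / ((n : ℕ) : ℝ)))

theorem measurable_clusterLength : Measurable clusterLength :=
  measurable_fst.min (Nat.measurable_floor.comp
    (Real.continuous_sqrt.measurable.comp measurable_snd).inv)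

theorem measurable_levelLength (n : ℕ+) : Measurable (levelLength n) :=
  Measurable.ite (measurableSet_lt (continuous_abs.measurable.comp measurable_snd) measurable_const)
    measurable_clusterLength measurable_const

theorem measurable_conditionedLength (n : ℕ+) : Measurable (conditionedLength n) :=
  measurable_clusterLength.comp (measurable_fst.prodMk (measurable_snd.mul_const _))

theorem lt_of_lt_clusterLength {s : ℕ} {a : ℕ × ℝ} (ha : 0 < a.2) (hs : 1 ≤ s)
    (h : s < clusterLength a) : a.2 < 1 / (s : ℝ) ^ 2 := by
  have hs' : (0 : ℝ) < s := by exact_mod_cast hs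
  have h1 : s + 1 ≤ ⌊(√a.2)⁻¹⌋₊ := (Nat.succ_le_of_lt h).trans (min_le_right _ _)
  have h2 : ((s + 1 : ℕ) : ℝ) ≤ (√a.2)⁻¹ := (Nat.le_floor_iff (by positivity)).1 h1
  have h3 : (s : ℝ) < (√a.2)⁻¹ := lt_of_lt_of_le (by push_cast; linarith) h2
  have h4 : √a.2 < 1 / s := by
    rw [one_div]
    exact (lt_inv_comm₀ hs' (Real.sqrt_pos.2 ha)).1 h3
  rw [Real.sqrt_lt' (by positivity)] at h4
  rwa [div_pow, one_pow] at h4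

theorem eventually_conditionedLength_eq {a : ℕ × ℝ} (ha : 0 < a.2) :
    ∀ᶠ n : ℕ+ in atTop, conditionedLength n a = a.1 := by
  have h0 : Tendsto (fun n : ℕ+ => √(a.2 * (1 / ((n : ℕ) : ℝ)))) atTop (𝓝[>] 0) := by
    refine tendsto_nhdsWithin_iff.2 ⟨?_, Eventually.of_forall fun n => ?_⟩
    · have h1 : Tendsto (fun n : ℕ+ => (1 : ℝ) / ((n : ℕ) : ℝ)) atTop (𝓝 0) :=
        tendsto_const_nhds.div_atTop tendsto_pnat_cast_atTop
      have h := (Real.continuous_sqrt.tendsto _).comp (h1.const_mul a.2)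
      simpa [Function.comp_def] using h
    · exact Real.sqrt_pos.2 (mul_pos ha (one_div_pos.2 (by exact_mod_cast n.pos)))
  filter_upwards [(tendsto_inv_nhdsGT_zero.comp h0).eventually_ge_atTop (a.1 : ℝ)] with n hn
  exact min_eq_left (Nat.le_floor hn)

theorem unifMeasure_eq (n : ℕ+) :
    unifMeasure = ENNReal.ofReal (1 / ((n : ℕ) : ℝ)) •
        unifMeasure.map (fun u => u * (1 / ((n : ℕ) : ℝ))) +
      volume.restrict (Set.Ioc (1 / ((n : ℕ) : ℝ)) 1) := by
  set p := 1 / ((n : ℕ) : ℝ) with hp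
  have hn : (1 : ℝ) ≤ ((n : ℕ) : ℝ) := by exact_mod_cast n.pos
  have hp0 : 0 < p := one_div_pos.2 (by linarith)
  have hp1 : p ≤ 1 := by rw [hp, div_le_one (by linarith)]; exact hn
  have hscale : volume.restrict (Set.Ioc 0 p) =
      ENNReal.ofReal p • unifMeasure.map (fun u => u * p) := by
    have hpre : (fun u : ℝ => u * p) ⁻¹' Set.Ioc 0 p = Set.Ioc 0 1 := by
      ext u
      simp only [Set.mem_preimage, Set.mem_Ioc]
      rw [mul_pos_iff_of_pos_right hp0, mul_le_iff_le_one_left hp0]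
    conv_lhs => rw [← Real.smul_map_volume_mul_right hp0.ne', Measure.restrict_smul,
      Measure.restrict_map (f := fun u : ℝ => u * p) (by fun_prop) measurableSet_Ioc, abs_of_pos hp0]
    rw [unifMeasure, ← hpre]
  rw [← hscale, unifMeasure, ← Measure.restrict_union (Set.Ioc_disjoint_Ioc_of_le le_rfl)
    measurableSet_Ioc, Set.Ioc_union_Ioc_eq_Ioc hp0.le hp1]

theorem ae_unifMeasure_mem : ∀ᵐ u ∂unifMeasure, 0 < u ∧ u < 1 := by
  have h1 : ∀ᵐ u ∂unifMeasure, u ∈ Set.Ioc (0 : ℝ) 1 := ae_restrict_mem measurableSet_Ioc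
  have h2 : ∀ᵐ u ∂unifMeasure, u ≠ (1 : ℝ) :=
    ae_restrict_of_ae (compl_mem_ae_iff.2 (measure_singleton (1 : ℝ)))
  filter_upwards [h1, h2] with u hu hne
  exact ⟨hu.1, lt_of_le_of_ne hu.2 hne⟩

theorem ae_markMeasure_snd {G : PMF ℕ} {p : ℝ → Prop} (h : ∀ᵐ u ∂unifMeasure, p u) :
    ∀ᵐ a ∂markMeasure G, p a.2 :=
  Measure.quasiMeasurePreserving_snd.ae h

/-- At level `n`, a cluster survives with probability `1 / n`. -/
theorem map_levelLength_markMeasure (G : PMF ℕ) (n : ℕ+) :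
    (markMeasure G).map (levelLength n) =
      ENNReal.ofReal (1 / ((n : ℕ) : ℝ)) • (markMeasure G).map (conditionedLength n) +
        ENNReal.ofReal (1 - 1 / ((n : ℕ) : ℝ)) • Measure.dirac 0 := by
  set p := 1 / ((n : ℕ) : ℝ) with hp
  have hn : (1 : ℝ) ≤ ((n : ℕ) : ℝ) := by exact_mod_cast n.pos
  have hp0 : 0 < p := one_div_pos.2 (by linarith)
  have hmul : Measurable fun a : ℕ × ℝ => (a.1, a.2 * p) :=
    measurable_fst.prodMk (measurable_snd.mul_const p)
  have hsplit : markMeasure G = ENNReal.ofReal p • (markMeasure G).map (fun a => (a.1, a.2 * p)) +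
      G.toMeasure.prod (volume.restrict (Set.Ioc p 1)) := by
    have hmap := Measure.map_prod_map G.toMeasure unifMeasure measurable_id
      (measurable_id.mul_const p)
    rw [Measure.map_id] at hmap
    conv_lhs => rw [markMeasure, unifMeasure_eq n, Measure.prod_add, Measure.prod_smul_right, ← hp]
    congr 2
  conv_lhs => rw [hsplit]
  rw [Measure.map_add _ _ (measurable_levelLength n), Measure.map_smul,
    Measure.map_map (measurable_levelLength n) hmul]
  congr 2
  · refine Measure.map_congr ?_
    filter_upwards [ae_markMeasure_snd (G := G) ae_unifMeasure_mem] with a ha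
    have : |a.2 * p| < p := by
      rw [abs_of_pos (mul_pos ha.1 hp0)]
      nlinarith
    simp only [Function.comp_apply, levelLength, conditionedLength, ← hp]
    rw [if_pos this]
  · have hae : levelLength n =ᵐ[G.toMeasure.prod (volume.restrict (Set.Ioc p 1))] fun _ => 0 := by
      have h : ∀ᵐ u ∂volume.restrict (Set.Ioc p 1), u ∈ Set.Ioc p 1 :=
        ae_restrict_mem measurableSet_Ioc
      filter_upwards [Measure.quasiMeasurePreserving_snd.ae h] with a ha
      refine if_neg (not_lt.2 ?_)
      rw [abs_of_pos (hp0.trans ha.1)]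
      exact ha.1.le
    rw [Measure.map_congr hae, Measure.map_const, Measure.prod_apply .univ]
    simp

/-! ### The stationary process -/

/-- The moving process with i.i.d. marks `ω i`, `i ∈ ℤ`: the cluster started at `i` covers
`[i, i + clusterLength (ω i))`, and `X k = -1 / H` where `H` is the supremum of the heights `1 / U`
of the clusters covering `k` (and `H = 1` if there is none). The absolute value, which is immaterial
since `U > 0` almost surely, keeps the infimum bounded below for every `ω`. -/
noncomputable def clusterProcess (k : ℤ) (ω : ℤ → ℕ × ℝ) : ℝ :=
  -⨅ s : ℕ, if s < clusterLength (ω (k - s)) then |(ω (k - s)).2| else 1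

theorem measurable_clusterProcess (k : ℤ) : Measurable (clusterProcess k) := by
  refine (Measurable.iInf fun s => ?_).neg
  have h : Measurable fun ω : ℤ → ℕ × ℝ => ω (k - s) := measurable_pi_apply _
  exact Measurable.ite ((measurable_clusterLength.comp h) measurableSet_Ioi)
    (continuous_abs.measurable.comp (measurable_snd.comp h)) measurable_const

theorem lt_levelLength_iff {n : ℕ+} {s : ℕ} {a : ℕ × ℝ} :
    s < levelLength n a ↔ s < clusterLength a ∧ |a.2| < 1 / ((n : ℕ) : ℝ) := by
  unfold levelLength
  split_ifs with h
  · exact (and_iff_left h).symm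
  · exact iff_of_false (Nat.not_lt_zero s) fun h' => h h'.2

theorem lt_clusterProcess_iff {n : ℕ+} {k : ℤ} {ω : ℤ → ℕ × ℝ} :
    -(1 / ((n : ℕ) : ℝ)) < clusterProcess k ω ↔ ∃ s : ℕ, s < levelLength n (ω (k - s)) := by
  have hn : (1 : ℝ) ≤ ((n : ℕ) : ℝ) := by exact_mod_cast n.pos
  have h1 : 1 / ((n : ℕ) : ℝ) ≤ 1 := by rw [div_le_one (by linarith)]; exact hn
  have hbdd : BddBelow (Set.range fun s : ℕ =>
      if s < clusterLength (ω (k - s)) then |(ω (k - s)).2| else 1) := by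
    refine ⟨0, ?_⟩
    rintro _ ⟨s, rfl⟩
    dsimp only
    split_ifs
    exacts [abs_nonneg _, zero_le_one]
  rw [clusterProcess, neg_lt_neg_iff, ciInf_lt_iff hbdd]
  refine exists_congr fun s => ?_
  rw [lt_levelLength_iff]
  split_ifs with h
  · exact (and_iff_right h).symm
  · exact iff_of_false (not_lt.2 h1) fun h' => h h'.1

theorem isStationaryProcess_clusterProcess (μ : Measure (ℕ × ℝ)) [IsProbabilityMeasure μ] :
    IsStationaryProcess (fun k : ℕ => clusterProcess k) (Measure.infinitePi fun _ : ℤ => μ) := by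
  refine ⟨fun k => measurable_clusterProcess k, fun l => ?_⟩
  have hX : Measurable fun (ω : ℤ → ℕ × ℝ) (k : ℕ) => clusterProcess k ω :=
    measurable_pi_iff.2 fun k => measurable_clusterProcess k
  have hshift : (Measure.infinitePi fun _ : ℤ => μ).map (fun ω i => ω (l + i)) =
      Measure.infinitePi fun _ : ℤ => μ :=
    Measure.map_infinitePi_infinitePi_of_inj (add_right_injective (l : ℤ))
  have hm : Measurable fun (ω : ℤ → ℕ × ℝ) (i : ℤ) => ω (l + i) := by fun_prop
  have heq : (fun (ω : ℤ → ℕ × ℝ) (k : ℕ) => clusterProcess ((l + k : ℕ) : ℤ) ω) =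
      (fun ω (k : ℕ) => clusterProcess k ω) ∘ fun ω i => ω (l + i) := by
    funext ω k
    simp only [clusterProcess, Function.comp_apply, Nat.cast_add, add_sub_assoc]
  refine ⟨?_, hX.aemeasurable, ?_⟩
  · exact (measurable_pi_iff.2 fun k => measurable_clusterProcess _).aemeasurable
  · rw [heq, ← Measure.map_map hX hm, hshift]

/-- The event that a cluster started before time `0` reaches time `0` at level `n`. -/
def oldClusterEvent (n : ℕ+) : Set (ℤ → ℕ × ℝ) :=
  ⋃ s : ℕ, {ω | s + 1 < levelLength n (ω (-(s + 1)))}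

theorem measurableSet_lt_levelLength (n : ℕ+) (s : ℕ) :
    MeasurableSet {a | s + 1 < levelLength n a} :=
  measurable_levelLength n measurableSet_Ioi

theorem measurableSet_oldClusterEvent (n : ℕ+) : MeasurableSet (oldClusterEvent n) :=
  .iUnion fun _ => measurableSet_lt measurable_const
    ((measurable_levelLength n).comp (measurable_pi_apply _))

theorem setOf_lt_clusterProcess_eq {n : ℕ+} {ω : ℤ → ℕ × ℝ} (h : ω ∉ oldClusterEvent n) :
    {k : ℕ | -(1 / ((n : ℕ) : ℝ)) < clusterProcess k ω} =
      clusterSet fun i : ℕ => levelLength n (ω i) := by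
  ext k
  simp only [Set.mem_ofPred_eq, lt_clusterProcess_iff, clusterSet]
  constructor
  · rintro ⟨s, hs⟩
    by_cases hsk : s ≤ k
    · exact ⟨s, hsk, by rwa [Nat.cast_sub hsk]⟩
    · refine (h (Set.mem_iUnion.2 ⟨s - k - 1, ?_⟩)).elim
      have e : -(((s - k - 1 : ℕ) : ℤ) + 1) = k - s := by omega
      rw [Set.mem_ofPred_eq, e]
      omega
  · rintro ⟨s, hsk, hs⟩
    exact ⟨s, by rwa [Nat.cast_sub hsk] at hs⟩

theorem unifMeasure_Iio_le (c : ℝ) : unifMeasure (Set.Iio c) ≤ ENNReal.ofReal c := by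
  rw [unifMeasure, Measure.restrict_apply measurableSet_Iio]
  refine (measure_mono (t := Set.Ioo 0 c) fun u hu => ⟨hu.2.1, hu.1⟩).trans ?_
  rw [Real.volume_Ioo, sub_zero]

theorem markMeasure_lt_levelLength_le (G : PMF ℕ) (n : ℕ+) (s : ℕ) :
    markMeasure G {a | s + 1 < levelLength n a} ≤
      ENNReal.ofReal (min (1 / ((n : ℕ) : ℝ)) (1 / ((s + 1 : ℕ) : ℝ) ^ 2)) := by
  set c := min (1 / ((n : ℕ) : ℝ)) (1 / ((s + 1 : ℕ) : ℝ) ^ 2)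
  have hle : markMeasure G {a | s + 1 < levelLength n a} ≤
      markMeasure G ((Set.univ : Set ℕ) ×ˢ Set.Iio c) := by
    refine measure_mono_ae ?_
    filter_upwards [ae_markMeasure_snd (G := G) ae_unifMeasure_mem] with a ha h
    obtain ⟨h1, h2⟩ := lt_levelLength_iff.1 h
    refine ⟨Set.mem_univ _, lt_min ((le_abs_self _).trans_lt h2) ?_⟩
    exact lt_of_lt_clusterLength ha.1 (Nat.succ_le_succ s.zero_le) h1
  refine hle.trans ?_
  rw [markMeasure, Measure.prod_prod, measure_univ, one_mul]
  exact unifMeasure_Iio_le c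

theorem tendsto_measure_oldClusterEvent (G : PMF ℕ) :
    Tendsto (fun n => (Measure.infinitePi fun _ : ℤ => markMeasure G).real (oldClusterEvent n))
      atTop (𝓝 0) := by
  set P := Measure.infinitePi fun _ : ℤ => markMeasure G
  let b : ℕ+ → ℕ → ℝ := fun n s => min (1 / ((n : ℕ) : ℝ)) (1 / ((s + 1 : ℕ) : ℝ) ^ 2)
  have hb0 : ∀ n s, 0 ≤ b n s := fun n s => le_min (by positivity) (by positivity)
  have hb1 : ∀ n s, b n s ≤ 1 / ((s + 1 : ℕ) : ℝ) ^ 2 := fun n s => min_le_right _ _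
  have hsum : Summable fun s : ℕ => 1 / ((s + 1 : ℕ) : ℝ) ^ 2 :=
    (summable_nat_add_iff 1).2 (Real.summable_one_div_nat_pow.2 one_lt_two)
  have hle : ∀ n, P.real (oldClusterEvent n) ≤ ∑' s, b n s := by
    intro n
    refine ENNReal.toReal_le_of_le_ofReal (tsum_nonneg (hb0 n)) ?_
    rw [ENNReal.ofReal_tsum_of_nonneg (hb0 n) (hsum.of_nonneg_of_le (hb0 n) (hb1 n))]
    refine (measure_iUnion_le _).trans (ENNReal.tsum_le_tsum fun s => ?_)
    have h := (measurePreserving_eval_infinitePi (fun _ : ℤ => markMeasure G)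
      (-((s : ℤ) + 1))).measure_preimage (measurableSet_lt_levelLength n s).nullMeasurableSet
    exact h.trans_le (markMeasure_lt_levelLength_le G n s)
  have hlim : Tendsto (fun n => ∑' s, b n s) atTop (𝓝 (∑' _ : ℕ, (0 : ℝ))) := by
    refine tendsto_tsum_of_dominated_convergence hsum (fun s => ?_) (Eventually.of_forall fun n s => ?_)
    · refine squeeze_zero (fun n => hb0 n s) (fun n => min_le_left _ _) ?_
      exact tendsto_const_nhds.div_atTop tendsto_pnat_cast_atTop
    · rw [Real.norm_of_nonneg (hb0 n s)]
      exact hb1 n s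
  rw [tsum_zero] at hlim
  exact squeeze_zero (fun n => measureReal_nonneg) hle hlim

/-! ### The coupling with the compound Poisson process -/

/-- The law of i.i.d. triples of an exponential gap, a multiplicity and a uniform variable. -/
noncomputable def couplingMeasure (G : PMF ℕ) : Measure (ℕ → ℝ × (ℕ × ℝ)) :=
  Measure.infinitePi fun _ => (expMeasure 1).prod (markMeasure G)

instance (G : PMF ℕ) : IsProbabilityMeasure (couplingMeasure G) := by
  unfold couplingMeasure; infer_instance

/-- The geometric gaps and cluster lengths of level `n` built from the triples `ω`. -/
noncomputable def gapsLengths (n : ℕ+) (ω : ℕ → ℝ × (ℕ × ℝ)) (j : ℕ) : ℕ × ℕ :=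
  (periodsBefore (levelPeriod n) (ω j).1, conditionedLength n (ω j).2)

theorem measurable_gapsLengths (n : ℕ+) : Measurable (gapsLengths n) :=
  measurable_pi_iff.2 fun j =>
    ((measurable_periodsBefore _).comp (measurable_fst.comp (measurable_pi_apply j))).prodMk
      ((measurable_conditionedLength n).comp (measurable_snd.comp (measurable_pi_apply j)))

theorem map_gapsLengths (G : PMF ℕ) (n : ℕ+) :
    (couplingMeasure G).map (gapsLengths n) = Measure.infinitePi fun _ =>
      ((expMeasure 1).map (periodsBefore (levelPeriod n))).prod
        ((markMeasure G).map (conditionedLength n)) := by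
  have h := Measure.infinitePi_map_pi (fun _ : ℕ => (expMeasure 1).prod (markMeasure G))
    (f := fun _ => Prod.map (periodsBefore (levelPeriod n)) (conditionedLength n))
    fun _ => (measurable_periodsBefore _).prodMap (measurable_conditionedLength n)
  simp only [← Measure.map_prod_map (expMeasure 1) (markMeasure G)
    (measurable_periodsBefore (levelPeriod n)) (measurable_conditionedLength n)] at h
  exact h

theorem map_levelLength_infinitePi (G : PMF ℕ) (n : ℕ+) :
    (Measure.infinitePi fun _ : ℤ => markMeasure G).map
      (fun ω (i : ℕ) => levelLength n (ω (i : ℤ))) =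
        Measure.infinitePi fun _ => (markMeasure G).map (levelLength n) := by
  have h1 : (Measure.infinitePi fun _ : ℤ => markMeasure G).map (fun ω (i : ℕ) => ω (i : ℤ)) =
      Measure.infinitePi fun _ : ℕ => markMeasure G :=
    Measure.map_infinitePi_infinitePi_of_inj Nat.cast_injective
  have h2 := Measure.infinitePi_map_pi (fun _ : ℕ => markMeasure G)
    (f := fun _ => levelLength n) fun _ => measurable_levelLength n
  have hm := measurable_levelLength n
  rw [← h2, ← h1, Measure.map_map (by fun_prop) (by fun_prop)]
  rfl

/-- The cluster lengths at level `n` have the same law as those built from the triples. -/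
theorem map_insertZeros_gapsLengths (G : PMF ℕ) {n : ℕ+} (hn : 2 ≤ n) :
    (couplingMeasure G).map (fun ω => insertZeros (gapsLengths n ω)) =
      (Measure.infinitePi fun _ : ℤ => markMeasure G).map
        (fun ω (i : ℕ) => levelLength n (ω (i : ℤ))) := by
  have h1 := Measure.isProbabilityMeasure_map (μ := expMeasure 1)
    (measurable_periodsBefore (levelPeriod n)).aemeasurable
  have h2 := Measure.isProbabilityMeasure_map (μ := markMeasure G)
    (measurable_conditionedLength n).aemeasurable
  have h3 := Measure.isProbabilityMeasure_map (μ := markMeasure G)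
    (measurable_levelLength n).aemeasurable
  have hγ := map_periodsBefore_eq (levelPeriod_pos hn)
  rw [exp_neg_levelPeriod hn, sub_sub_cancel] at hγ
  rw [map_levelLength_infinitePi, ← map_insertZeros_infinitePi _ _ _ _ _ hγ
    (map_levelLength_markMeasure G n), ← map_gapsLengths,
    Measure.map_map measurable_insertZeros (measurable_gapsLengths n)]
  rfl

theorem measure_forall_gap_le_eq_zero (G : PMF ℕ) (M : ℕ) :
    couplingMeasure G {ω | ∀ j, (ω j).1 ≤ M} = 0 := by
  set r : ℝ≥0∞ := ENNReal.ofReal (1 - Real.exp (-(M : ℝ))) with hr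
  have hr1 : r < 1 := by
    rw [hr, ENNReal.ofReal_lt_one]
    linarith [Real.exp_pos (-(M : ℝ))]
  have hle : ∀ N : ℕ, couplingMeasure G {ω | ∀ j, (ω j).1 ≤ M} ≤ r ^ N := by
    intro N
    have hS : MeasurableSet (Set.Iic (M : ℝ) ×ˢ (Set.univ : Set (ℕ × ℝ))) :=
      measurableSet_Iic.prod .univ
    refine (measure_mono (t := Set.pi (Finset.range N : Set ℕ)
      fun _ => Set.Iic (M : ℝ) ×ˢ (Set.univ : Set (ℕ × ℝ))) fun ω hω j _ => ?_).trans ?_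
    · exact ⟨hω j, Set.mem_univ _⟩
    · rw [couplingMeasure, Measure.infinitePi_pi _ fun _ _ => hS, Measure.prod_prod, measure_univ,
        mul_one, expMeasure_one_Iic, if_pos (Nat.cast_nonneg M)]
      simp [hr]
  exact le_antisymm (ge_of_tendsto' (ENNReal.tendsto_pow_atTop_nhds_zero_of_lt_one hr1) hle)
    zero_le

theorem ae_coupling_of_ae {G : PMF ℕ} {p : ℝ × (ℕ × ℝ) → Prop}
    (h : ∀ᵐ x ∂(expMeasure 1).prod (markMeasure G), p x) :
    ∀ᵐ ω ∂couplingMeasure G, ∀ j, p (ω j) :=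
  ae_all_iff.2 fun j => (measurePreserving_eval_infinitePi
    (fun _ : ℕ => (expMeasure 1).prod (markMeasure G)) j).quasiMeasurePreserving.ae h

theorem ae_gap_pos (G : PMF ℕ) : ∀ᵐ ω ∂couplingMeasure G, ∀ j, 0 < (ω j).1 := by
  have h : ∀ᵐ x ∂expMeasure 1, 0 < x := by
    refine measure_mono_null (t := Set.Iic 0) (fun x (hx : ¬ 0 < x) => not_lt.1 hx) ?_
    rw [expMeasure_one_Iic]
    simp
  exact ae_coupling_of_ae (Measure.quasiMeasurePreserving_fst.ae h)

theorem ae_unif_pos (G : PMF ℕ) : ∀ᵐ ω ∂couplingMeasure G, ∀ j, 0 < (ω j).2.2 :=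
  ae_coupling_of_ae (Measure.quasiMeasurePreserving_snd.ae
    (ae_markMeasure_snd (ae_unifMeasure_mem.mono fun _ hu => hu.1)))

theorem ae_tendsto_pointTime (G : PMF ℕ) :
    ∀ᵐ ω ∂couplingMeasure G, Tendsto (pointTime fun j => (ω j).1) atTop atTop := by
  have hM : ∀ᵐ ω ∂couplingMeasure G, ∀ M : ℕ, ¬ ∀ j, (ω j).1 ≤ (M : ℝ) :=
    ae_all_iff.2 fun M => measure_eq_zero_iff_ae_notMem.1 (measure_forall_gap_le_eq_zero G M)
  filter_upwards [hM, ae_gap_pos G] with ω hω hpos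
  refine tendsto_atTop_atTop_of_monotone (monotone_nat_of_le_succ fun j => ?_) fun b => ?_
  · simp only [pointTime, Finset.sum_range_succ _ (j + 1)]
    exact le_add_of_nonneg_right (hpos _).le
  · obtain ⟨M, hbM⟩ := exists_nat_ge b
    obtain ⟨j, hj⟩ := not_forall.1 (hω M)
    refine ⟨j, hbM.trans ((not_le.1 hj).le.trans ?_)⟩
    exact Finset.single_le_sum (f := fun i => (ω i).1) (fun i _ => (hpos i).le)
      (Finset.mem_range.2 j.lt_succ_self)

theorem ae_tendsto_latticeMeasure (G : PMF ℕ) :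
    ∀ᵐ ω ∂couplingMeasure G,
      Tendsto (fun n => latticeMeasure n (clusterSet (insertZeros (gapsLengths n ω)))) atTop
        (𝓝 (compoundMeasure (fun j => (ω j).1) fun j => (ω j).2.1)) := by
  filter_upwards [ae_gap_pos G, ae_unif_pos G, ae_tendsto_pointTime G] with ω h1 h2 h3
  exact tendsto_latticeMeasure_insertZeros h1 h3 (fun j => tendsto_periodsBefore_div (h1 j))
    fun j => eventually_conditionedLength_eq (h2 j)

theorem isCompoundPoissonProcess_compoundMeasure (G : PMF ℕ) :
    IsCompoundPoissonProcess
      (fun ω => compoundMeasure (fun j => (ω j).1) fun j => (ω j).2.1) 1 G (couplingMeasure G) := by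
  have hlaw : ∀ i, HasLaw (fun ω : ℕ → ℝ × (ℕ × ℝ) => ω i) ((expMeasure 1).prod (markMeasure G))
      (couplingMeasure G) := fun i =>
    (measurePreserving_eval_infinitePi (fun _ : ℕ => (expMeasure 1).prod (markMeasure G)) i).hasLaw
  have hfst : HasLaw Prod.fst (expMeasure 1) ((expMeasure 1).prod (markMeasure G)) :=
    measurePreserving_fst.hasLaw
  have hsnd : HasLaw Prod.snd (markMeasure G) ((expMeasure 1).prod (markMeasure G)) :=
    measurePreserving_snd.hasLaw
  have hζ : HasLaw Prod.fst G.toMeasure (markMeasure G) := measurePreserving_fst.hasLaw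
  refine ⟨fun j ω => (ω j).1, fun j ω => (ω j).2.1, fun i => hfst.comp (hlaw i), ?_,
    fun i => hζ.comp (hsnd.comp (hlaw i)), ?_, ?_, ?_⟩
  · exact iIndepFun_infinitePi (X := fun _ (x : ℝ × (ℕ × ℝ)) => x.1) fun _ =>
      measurable_fst
  · exact iIndepFun_infinitePi (X := fun _ (x : ℝ × (ℕ × ℝ)) => x.2.1) fun _ =>
      measurable_fst.comp measurable_snd
  · have h := indepFun_fst_snd_infinitePi (expMeasure 1) (markMeasure G)
    have hm : Measurable fun (x : ℕ → ℕ × ℝ) i => (x i).1 := by fun_prop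
    exact h.comp measurable_id hm
  · filter_upwards [ae_tendsto_pointTime G] with ω hω
    simp only [compoundMeasure, if_pos hω]
    rfl

/-! ### Convergence in distribution -/

theorem abs_integral_sub_integral_le {Ω E : Type*} [MeasurableSpace Ω] [TopologicalSpace E]
    [MeasurableSpace E] [OpensMeasurableSpace E] {P : Measure Ω} [IsProbabilityMeasure P]
    (F : BoundedContinuousFunction E ℝ) {a b : Ω → E} (ha : Measurable a) (hb : Measurable b)
    {B : Set Ω} (hB : MeasurableSet B) (h : ∀ ω ∉ B, a ω = b ω) :
    |∫ ω, F (a ω) ∂P - ∫ ω, F (b ω) ∂P| ≤ 2 * ‖F‖ * P.real B := by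
  have hint : ∀ {c : Ω → E}, Measurable c → Integrable (fun ω => F (c ω)) P := fun hc =>
    Integrable.of_bound (F.continuous.measurable.comp hc).aestronglyMeasurable ‖F‖
      (Eventually.of_forall fun ω => F.norm_coe_le_norm _)
  rw [← integral_sub (hint ha) (hint hb), ← Real.norm_eq_abs]
  have hI : ∫ ω, B.indicator (fun _ => 2 * ‖F‖) ω ∂P = 2 * ‖F‖ * P.real B := by
    rw [integral_indicator_const _ hB, smul_eq_mul, mul_comm]
  rw [← hI]
  refine norm_integral_le_of_norm_le ((integrable_const _).indicator hB)
    (Eventually.of_forall fun ω => ?_)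
  by_cases hω : ω ∈ B
  · rw [Set.indicator_of_mem hω, two_mul]
    exact (norm_sub_le _ _).trans (add_le_add (F.norm_coe_le_norm _) (F.norm_coe_le_norm _))
  · rw [h ω hω, sub_self, norm_zero, Set.indicator_of_notMem hω]

theorem tendstoInDistribution_exceedanceProcess (G : PMF ℕ) :
    TendstoInDistribution
      (fun n : ℕ+ => exceedanceProcess (fun k : ℕ => clusterProcess k) n (-(1 / ((n : ℕ) : ℝ))))
      atTop (fun ω => compoundMeasure (fun j => (ω j).1) fun j => (ω j).2.1)
      (fun _ => Measure.infinitePi fun _ : ℤ => markMeasure G) (couplingMeasure G) := by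
  set P := Measure.infinitePi fun _ : ℤ => markMeasure G
  have hX : ∀ n : ℕ+, Measurable
      (exceedanceProcess (fun k : ℕ => clusterProcess k) n (-(1 / ((n : ℕ) : ℝ)))) := fun n =>
    measurable_exceedanceProcess (fun k : ℕ => measurable_clusterProcess k) n _
  have hN : AEMeasurable (fun ω : ℕ → ℝ × (ℕ × ℝ) =>
      compoundMeasure (fun j => (ω j).1) fun j => (ω j).2.1) (couplingMeasure G) :=
    aemeasurable_compoundMeasure (by fun_prop) (by fun_prop) (ae_tendsto_pointTime G)
  refine ⟨fun n => (hX n).aemeasurable, hN, ?_⟩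
  refine ProbabilityMeasure.tendsto_iff_forall_integral_tendsto.2 fun F => ?_
  change Tendsto (fun n : ℕ+ => ∫ x, F x ∂P.map (exceedanceProcess _ n _)) atTop
    (𝓝 (∫ x, F x ∂(couplingMeasure G).map _))
  rw [integral_map hN F.continuous.measurable.aestronglyMeasurable]
  simp only [fun n : ℕ+ => integral_map (hX n).aemeasurable (μ := P)
    F.continuous.measurable.aestronglyMeasurable]
  have hL : ∀ n : ℕ+, Measurable fun (ω : ℤ → ℕ × ℝ) (i : ℕ) => levelLength n (ω (i : ℤ)) :=
    fun n => measurable_pi_iff.2 fun i => (measurable_levelLength n).comp (measurable_pi_apply _)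
  have hC : ∀ n : ℕ+, Measurable fun l : ℕ → ℕ => latticeMeasure n (clusterSet l) := fun n =>
    (continuous_latticeMeasure_clusterSet n).measurable
  have hY : ∀ n : ℕ+, Measurable fun ω => insertZeros (gapsLengths n ω) := fun n =>
    measurable_insertZeros.comp (measurable_gapsLengths n)
  -- Discarding the clusters started before time `0` changes the expectation by `o(1)`.
  have hdiff : Tendsto (fun n : ℕ+ =>
      ∫ ω, F (exceedanceProcess (fun k : ℕ => clusterProcess k) n (-(1 / ((n : ℕ) : ℝ))) ω) ∂P -
        ∫ ω, F (latticeMeasure n (clusterSet fun i : ℕ => levelLength n (ω (i : ℤ)))) ∂P) atTop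
      (𝓝 0) := by
    have h0 := (tendsto_measure_oldClusterEvent G).const_mul (2 * ‖F‖)
    rw [mul_zero] at h0
    refine squeeze_zero_norm (fun n => ?_) h0
    refine abs_integral_sub_integral_le F (hX n) ((hC n).comp (hL n))
      (measurableSet_oldClusterEvent n) fun ω hω => ?_
    rw [exceedanceProcess_eq_latticeMeasure, setOf_lt_clusterProcess_eq hω]
    rfl
  have hcoup : Tendsto (fun n : ℕ+ =>
      ∫ ω, F (latticeMeasure n (clusterSet (insertZeros (gapsLengths n ω)))) ∂couplingMeasure G)
      atTop (𝓝 (∫ ω, F (compoundMeasure (fun j => (ω j).1) fun j => (ω j).2.1)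
        ∂couplingMeasure G)) := by
    refine tendsto_integral_filter_of_dominated_convergence (fun _ => ‖F‖)
      (Eventually.of_forall fun n => ?_) (Eventually.of_forall fun n => Eventually.of_forall
        fun ω => F.norm_coe_le_norm _) (integrable_const _) ?_
    · exact (F.continuous.measurable.comp ((hC n).comp (hY n))).aestronglyMeasurable
    · filter_upwards [ae_tendsto_latticeMeasure G] with ω hω
      exact (F.continuous.tendsto _).comp hω
  have hsame : ∀ᶠ n : ℕ+ in atTop,
      ∫ ω, F (latticeMeasure n (clusterSet (insertZeros (gapsLengths n ω)))) ∂couplingMeasure G =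
        ∫ ω, F (latticeMeasure n (clusterSet fun i : ℕ => levelLength n (ω (i : ℤ)))) ∂P := by
    filter_upwards [eventually_ge_atTop 2] with n hn
    have hF := F.continuous.measurable.comp (hC n)
    have h1 := integral_map (hY n).aemeasurable (μ := couplingMeasure G) hF.aestronglyMeasurable
    have h2 := integral_map (hL n).aemeasurable (μ := P) hF.aestronglyMeasurable
    rw [map_insertZeros_gapsLengths G hn] at h1
    exact h1.symm.trans h2
  simpa using hdiff.add (hcoup.congr' hsame)

theorem theorem1 (G : PMF ℕ) (hG : G 0 = 0) :
    ∃ (Ω : Type) (_ : MeasurableSpace Ω) (P : Measure Ω) (_ : IsProbabilityMeasure P)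
      (X : ℕ → Ω → ℝ),
      IsStationaryProcess X P ∧
      ∃ u : ℕ+ → ℝ, StrictMono u ∧
      ∃ (Ω' : Type) (_ : MeasurableSpace Ω') (P' : Measure Ω') (_ : IsProbabilityMeasure P')
        (N : Ω' → LocFinMeasure) (r : ℝ),
        0 < r ∧ IsCompoundPoissonProcess N r G P' ∧
        TendstoInDistribution (fun n : ℕ+ => exceedanceProcess X n (u n)) atTop N
          (fun _ => P) P' := by
  refine ⟨ℤ → ℕ × ℝ, inferInstance, Measure.infinitePi fun _ : ℤ => markMeasure G, inferInstance,
    fun k => clusterProcess k, isStationaryProcess_clusterProcess _,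
    fun n => -(1 / ((n : ℕ) : ℝ)), fun m n hmn => ?_, ℕ → ℝ × (ℕ × ℝ), inferInstance,
    couplingMeasure G, inferInstance, _, 1, one_pos, isCompoundPoissonProcess_compoundMeasure G,
    tendstoInDistribution_exceedanceProcess G⟩
  exact neg_lt_neg (one_div_lt_one_div_of_lt (by exact_mod_cast m.pos) (by exact_mod_cast hmn))
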